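/- Let $k$ be a field of characteristic zero and let $R$ be a finite-dimensional solvable Lie algebra over $k$, with derivation Lie algebra $\mathrm{Der}\,R \subseteq \mathfrak{gl}(R)$. Say that a finite-dimensional semisimple Lie algebra $S$ over $k$ (that is, one whose solvable radical is zero) is a \emph{nontrivial Levi extension} of $R$ if there is a representation $\rho : S \to \mathfrak{gl}(R)$ with $\rho(S) \subseteq \mathrm{Der}\,R$ and $\rho \neq 0$. Then $R$ admits a nontrivial Levi extension if and only if the Lie algebra $\mathrm{Der}\,R$ is not solvable. -/

import Mathlib

universe u v

section LeviExtensions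

attribute [local instance 100] LieRing.ofAssociativeRing

/-- A representation `ρ : S → 𝔤𝔩(R)` of a Lie algebra `S` on the vector space underlying a Lie
algebra `R` *acts by derivations* if `ρ(S) ⊆ Der R`, i.e. every `ρ s` is a derivation of `R`. -/
def ActsByDerivations {k R S : Type*} [Field k] [LieRing R] [LieAlgebra k R]
    [LieRing S] [LieAlgebra k S] (ρ : S →ₗ⁅k⁆ Module.End k R) : Prop :=
  ∀ s : S, ∃ D : LieDerivation k R R, (D : R →ₗ[k] R) = ρ s

/-- `S` is a *nontrivial Levi extension* of `R`: `S` is semisimple (its solvable radical is zero)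
and there is a representation `ρ : S → 𝔤𝔩(R)` with `ρ(S) ⊆ Der R` which is not the trivial
representation. -/
def IsNontrivialLeviExtension (k R S : Type*) [Field k] [LieRing R] [LieAlgebra k R]
    [LieRing S] [LieAlgebra k S] : Prop :=
  LieAlgebra.HasTrivialRadical k S ∧
    ∃ ρ : S →ₗ⁅k⁆ Module.End k R, ActsByDerivations ρ ∧ ∃ (s : S) (a : R), ρ s a ≠ 0

/-- `R` *admits a nontrivial Levi extension*: some finite-dimensional Lie algebra `S` over `k` is a
nontrivial Levi extension of `R`. (Every finite-dimensional `S` acting nontrivially on `R` is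
isomorphic to one whose underlying type lives in the universe of `R`.) -/
def AdmitsNontrivialLeviExtension (k : Type u) (R : Type v) [Field k] [LieRing R]
    [LieAlgebra k R] : Prop :=
  ∃ (S : Type v) (_ : LieRing S) (_ : LieAlgebra k S),
    FiniteDimensional k S ∧ IsNontrivialLeviExtension k R S

end LeviExtensions

-- A nontrivial Levi extension amounts to a nonzero morphism from a semisimple algebra to `Der R`. A
-- solvable target admits none: the Killing complement of the kernel embeds in it, so is a solvable
-- ideal, hence zero.
--
-- Conversely, if `Der R` is not solvable, a nonsolvable subalgebra `L` of least dimension is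
-- semisimple, and its inclusion is the required representation. Indeed, let `A` be a nonzero
-- abelian ideal of `L`. By induction on dimension `L ⧸ A` has trivial radical, so it is simple, and
-- Casimir operators show that its representations are spanned by invariants and brackets. A
-- Whitehead-type argument then makes `A` central: otherwise a proper subalgebra of `L` would map
-- onto `L ⧸ A`. But `L = [L, L]`, so the adjoint representation, now one of `L ⧸ A`, has no nonzero
-- invariants, and `A = 0`.

attribute [local instance 100] LieRing.ofAssociativeRing

/-! ### Trace forms and the Casimir operator -/

namespace LieModule

open Module LinearMap

variable {k S V : Type*} [Field k] [LieRing S] [LieAlgebra k S] [FiniteDimensional k S]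
  [AddCommGroup V] [Module k V] [LieRingModule S V] [LieModule k S V]

/-- If the trace form of a representation is nondegenerate, the representation carries a Casimir
operator: it commutes with the action, takes values in `S • V`, and its trace is `dim S`. -/
theorem exists_casimir (h : (traceForm k S V).Nondegenerate) :
    ∃ c : End k V, (∀ (x : S) (v : V), c ⁅x, v⁆ = ⁅x, c v⁆) ∧
      (∀ W : Submodule k V, (∀ (x : S) (v : V), ⁅x, v⁆ ∈ W) → ∀ v, c v ∈ W) ∧
      trace k V c = finrank k S := by
  classical
  let b := finBasis k S
  let B := traceForm k S V
  let d := B.dualBasis h b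
  have hbd (i j) : B (b i) (d j) = if i = j then 1 else 0 :=
    LinearMap.BilinForm.apply_dualBasis_right h ⟨traceForm_comm k S V⟩ b i j
  have hb (x : S) : x = ∑ j, B x (d j) • b j := by
    conv_lhs => rw [← b.sum_repr x]
    refine Finset.sum_congr rfl fun j _ ↦ ?_
    congr 1
    rw [show B x (d j) = B (∑ i, b.repr x i • b i) (d j) by rw [b.sum_repr], map_sum,
      LinearMap.sum_apply]
    simp only [map_smul, LinearMap.smul_apply, hbd]
    simp
  have hd (x : S) : x = ∑ j, B x (b j) • d j := by
    conv_lhs => rw [← d.sum_repr x]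
    simp [d, LinearMap.BilinForm.dualBasis_repr_apply]
  refine ⟨∑ i, toEnd k S V (b i) * toEnd k S V (d i), fun x v ↦ ?_, fun W hW v ↦ ?_, ?_⟩
  · have key : ∑ i, ⁅⁅x, b i⁆, ⁅d i, v⁆⁆ + ∑ i, ⁅b i, ⁅⁅x, d i⁆, v⁆⁆ = 0 := by
      have h1 (i) : ⁅⁅x, b i⁆, ⁅d i, v⁆⁆ = ∑ j, B ⁅x, b i⁆ (d j) • ⁅b j, ⁅d i, v⁆⁆ := by
        conv_lhs => rw [hb ⁅x, b i⁆]
        simp [sum_lie]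
      have h2 (i) : ⁅b i, ⁅⁅x, d i⁆, v⁆⁆ = ∑ j, B ⁅x, d i⁆ (b j) • ⁅b i, ⁅d j, v⁆⁆ := by
        conv_lhs => rw [hd ⁅x, d i⁆]
        simp [sum_lie, lie_sum]
      simp_rw [h1, h2]
      rw [Finset.sum_comm, ← Finset.sum_add_distrib]
      refine Finset.sum_eq_zero fun i _ ↦ ?_
      rw [← Finset.sum_add_distrib]
      refine Finset.sum_eq_zero fun j _ ↦ ?_
      rw [← add_smul]
      -- Invariance of `B`: the matrices of `ad x` in the dual bases `b` and `d` are negative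
      -- transposes.
      have : B ⁅x, b j⁆ (d i) + B ⁅x, d i⁆ (b j) = 0 := by
        rw [traceForm_apply_lie_apply' k S V x (b j), traceForm_comm k S V (b j),
          neg_add_cancel]
      rw [this, zero_smul]
    simp only [LinearMap.sum_apply, Module.End.mul_apply, toEnd_apply_apply, lie_sum]
    rw [eq_comm, ← sub_eq_zero, ← Finset.sum_sub_distrib, ← key, ← Finset.sum_add_distrib]
    refine Finset.sum_congr rfl fun i _ ↦ ?_
    simp only [lie_lie, lie_sub]
    abel
  · simp only [LinearMap.sum_apply, Module.End.mul_apply, toEnd_apply_apply]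
    exact sum_mem fun i _ ↦ hW _ _
  · have htr (i) : trace k V (toEnd k S V (b i) * toEnd k S V (d i)) = 1 := by
      have := hbd i i
      rwa [if_pos rfl] at this
    simp [htr]

variable [CharZero k] [FiniteDimensional k V]

omit [FiniteDimensional k S] in
variable (k S V) in
/-- A representation of a simple Lie algebra with vanishing trace form is trivial. -/
theorem isTrivial_of_traceForm_eq_zero [LieAlgebra.IsSimple k S] (h : traceForm k S V = 0) :
    IsTrivial S V := by
  have hn := isNilpotent_derivedSeries_of_traceForm_eq_zero h
  have hns : ¬ LieAlgebra.IsSolvable S := fun _ ↦ by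
    have := LieAlgebra.HasTrivialRadical.eq_bot_of_isSolvable (⊤ : LieIdeal k S)
    have := LieAlgebra.IsSimple.nontrivial k (L := S)
    exact top_ne_bot ‹(⊤ : LieIdeal k S) = ⊥›
  have hd : LieAlgebra.derivedSeries k S 1 = ⊤ := by
    refine (LieAlgebra.IsSimple.eq_bot_or_eq_top _).resolve_left fun h0 ↦ hns ?_
    exact LieAlgebra.IsSolvable.mk h0
  have hnil (x : S) : _root_.IsNilpotent (toEnd k S V x) :=
    (isNilpotent_iff_forall' (R := k)).mp hn ⟨x, hd ▸ LieSubmodule.mem_top x⟩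
  -- A faithful action by nilpotent operators would make `S` nilpotent, by Engel.
  rcases LieAlgebra.IsSimple.eq_bot_or_eq_top (LieModule.ker k S V) with h0 | h0
  · have hinj : Function.Injective (toEnd k S V) :=
      ((isFaithful_iff_ker_eq_bot k S V).mpr h0).injective_toEnd
    have : LieRing.IsNilpotent (toEnd k S V).range := by
      rw [LieAlgebra.isNilpotent_iff_forall (R := k)]
      rintro ⟨_, x, rfl⟩
      exact LieAlgebra.isNilpotent_ad_of_isNilpotent (hnil x)
    have : LieRing.IsNilpotent S := (LieEquiv.ofInjective _ hinj).injective.lieAlgebra_isNilpotent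
    exact (hns inferInstance).elim
  · refine ⟨fun x v ↦ ?_⟩
    have : x ∈ LieModule.ker k S V := h0 ▸ LieSubmodule.mem_top x
    exact (LieModule.mem_ker k S V x).mp this v

end LieModule

/-! ### Invariants and brackets for a simple algebra -/

namespace LieModule

open Module LinearMap

variable {k S V : Type*} [Field k] [CharZero k] [LieRing S] [LieAlgebra k S]
  [FiniteDimensional k S] [LieAlgebra.IsSimple k S]
  [AddCommGroup V] [Module k V] [LieRingModule S V] [LieModule k S V] [FiniteDimensional k V]

omit [CharZero k] [FiniteDimensional k S] [FiniteDimensional k V] in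
variable (k S V) in
-- By invariance the kernel of the trace form is an ideal.
theorem traceForm_nondegenerate_of_ne_zero (h : traceForm k S V ≠ 0) :
    (traceForm k S V).Nondegenerate := by
  let I : LieIdeal k S :=
    { LinearMap.ker (traceForm k S V) with
      lie_mem := fun {x m} hm ↦ by
        change traceForm k S V m = 0 at hm
        change traceForm k S V ⁅x, m⁆ = 0
        ext z
        rw [traceForm_apply_lie_apply' k S V x m, hm]
        simp }
  have hI : I = ⊥ := (LieAlgebra.IsSimple.eq_bot_or_eq_top I).resolve_right fun hI ↦ h <| by
    refine LinearMap.ext fun x ↦ ?_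
    have hx : x ∈ I := hI ▸ LieSubmodule.mem_top x
    exact hx
  refine (traceForm_isSymm k S V).isRefl.nondegenerate_iff_separatingLeft.mpr ?_
  rw [separatingLeft_iff_ker_eq_bot]
  exact congrArg LieSubmodule.toSubmodule hI

/-- A finite-dimensional representation of a simple Lie algebra is the sum of its invariants and
of the span of its brackets. -/
theorem mem_of_forall_lie_mem_of_forall_invariant_mem (W : Submodule k V)
    (hW : ∀ (x : S) (v : V), ⁅x, v⁆ ∈ W) (hW' : ∀ v : V, (∀ x : S, ⁅x, v⁆ = 0) → v ∈ W) (v : V) :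
    v ∈ W := by
  induction hn : finrank k V using Nat.strong_induction_on generalizing V with
  | _ n ih =>
  by_cases h0 : traceForm k S V = 0
  · have := isTrivial_of_traceForm_eq_zero k S V h0
    exact hW' v fun x ↦ trivial_lie_zero S V x v
  obtain ⟨c, hc, hcW, htr⟩ := exists_casimir (traceForm_nondegenerate_of_ne_zero k S V h0)
  obtain ⟨N, hN⟩ := Filter.eventually_atTop.mp c.eventually_isCompl_ker_pow_range_pow
  -- Fitting decomposition of `c`. The exponent `N + 1` leaves at least one factor `c`, which puts
  -- the range in `W`; the kernel is proper because `trace c = dim S ≠ 0`, so induction applies to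
  -- it.
  have hcompl := hN (N + 1) N.le_succ
  have hcomm (m : ℕ) (x : S) (v : V) : (c ^ m) ⁅x, v⁆ = ⁅x, (c ^ m) v⁆ := by
    induction m with
    | zero => rfl
    | succ m ihm => rw [pow_succ', End.mul_apply, ihm, hc, End.mul_apply]
  let V₀ : LieSubmodule k S V :=
    { LinearMap.ker (c ^ (N + 1)) with
      lie_mem := fun {x m} hm ↦ by
        change (c ^ (N + 1)) m = 0 at hm
        change (c ^ (N + 1)) ⁅x, m⁆ = 0
        rw [hcomm, hm, lie_zero] }
  have hlt : finrank k V₀ < n := by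
    rw [← hn]
    refine Submodule.finrank_lt (s := V₀.toSubmodule) fun htop ↦ ?_
    have hnil : _root_.IsNilpotent c := ⟨N + 1, LinearMap.ker_eq_top.mp htop⟩
    have h1 := (isNilpotent_trace_of_isNilpotent hnil).eq_zero
    rw [htr, Nat.cast_eq_zero] at h1
    have := LieAlgebra.IsSimple.nontrivial k (L := S)
    exact (finrank_pos (R := k) (M := S)).ne' h1
  have hV₀ : V₀.toSubmodule ≤ W := fun v hv ↦
    ih _ hlt (V := V₀) (W.comap V₀.toSubmodule.subtype) (fun x u ↦ hW x u)
      (fun u hu ↦ hW' u fun x ↦ congrArg Subtype.val (hu x)) ⟨v, hv⟩ rfl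
  have hV₁ : LinearMap.range (c ^ (N + 1)) ≤ W := by
    rintro _ ⟨u, rfl⟩
    rw [pow_succ', End.mul_apply]
    exact hcW W hW _
  exact (sup_le hV₀ hV₁) (hcompl.sup_eq_top ▸ Submodule.mem_top)

/-- A representation of a simple Lie algebra that is spanned by its brackets has no nonzero
invariants. -/
theorem eq_zero_of_invariant_of_span_lie_eq_top
    (h : Submodule.span k {u : V | ∃ (x : S) (v : V), ⁅x, v⁆ = u} = ⊤)
    (v : V) (hv : ∀ x : S, ⁅x, v⁆ = 0) : v = 0 := by
  refine (forall_dual_apply_eq_zero_iff k v).mp fun f ↦ ?_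
  -- Dualize: functionals killing `v` include all brackets, and an invariant functional kills every
  -- bracket, hence is zero.
  have := mem_of_forall_lie_mem_of_forall_invariant_mem (k := k) (S := S) (V := V →ₗ[k] k)
    (LinearMap.ker (Dual.eval k V v)) (fun x f ↦ ?_) (fun f hf ↦ ?_) f
  · exact this
  · change ⁅x, f⁆ v = 0
    rw [Module.Dual.lie_apply, hv, map_zero, neg_zero]
  · have : f = 0 := by
      refine LinearMap.ext_on h ?_
      rintro _ ⟨x, u, rfl⟩
      have := LinearMap.congr_fun (hf x) u
      simpa using this
    simp [this]

end LieModule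

/-! ### Representations of a simple quotient -/

namespace LieIdeal

variable {k L V : Type*} [Field k] [LieRing L] [LieAlgebra k L] (A : LieIdeal k L)
  [AddCommGroup V] [Module k V] [LieRingModule L V] [LieModule k L V]

/-- The quotient map by an ideal, as a morphism of Lie algebras. -/
def quotientMk : L →ₗ⁅k⁆ L ⧸ A where
  toLinearMap := A.toSubmodule.mkQ
  map_lie' {x y} := LieSubmodule.Quotient.mk_bracket (I := A) x y

theorem quotientMk_surjective : Function.Surjective A.quotientMk :=
  Submodule.mkQ_surjective _

theorem quotientMk_eq_zero {x : L} : A.quotientMk x = 0 ↔ x ∈ A :=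
  Submodule.Quotient.mk_eq_zero _

/-- A representation on which an ideal acts trivially descends to the quotient. -/
def quotientToEnd (h : ∀ a ∈ A, ∀ v : V, ⁅a, v⁆ = 0) : L ⧸ A →ₗ⁅k⁆ Module.End k V where
  toLinearMap := A.toSubmodule.liftQ (LieModule.toEnd k L V : L →ₗ[k] Module.End k V)
    fun a ha ↦ LinearMap.ext fun v ↦ h a ha v
  map_lie' {x y} := by
    obtain ⟨x, rfl⟩ := A.quotientMk_surjective x
    obtain ⟨y, rfl⟩ := A.quotientMk_surjective y
    rw [← LieHom.map_lie]
    exact LieHom.map_lie (LieModule.toEnd k L V) x y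

variable [CharZero k] [FiniteDimensional k L] [LieAlgebra.IsSimple k (L ⧸ A)]
  [FiniteDimensional k V]

theorem mem_of_forall_lie_mem_of_forall_invariant_mem (h : ∀ a ∈ A, ∀ v : V, ⁅a, v⁆ = 0)
    (W : Submodule k V) (hW : ∀ (x : L) (v : V), ⁅x, v⁆ ∈ W)
    (hW' : ∀ v : V, (∀ x : L, ⁅x, v⁆ = 0) → v ∈ W) (v : V) : v ∈ W := by
  let := LieRingModule.compLieHom V (A.quotientToEnd h)
  have := LieModule.compLieHom V (A.quotientToEnd h)
  refine LieModule.mem_of_forall_lie_mem_of_forall_invariant_mem (S := L ⧸ A) W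
    (fun x v ↦ ?_) (fun v hv ↦ hW' v fun x ↦ hv (A.quotientMk x)) v
  obtain ⟨x, rfl⟩ := A.quotientMk_surjective x
  exact hW x v

theorem eq_zero_of_invariant_of_span_lie_eq_top (h : ∀ a ∈ A, ∀ v : V, ⁅a, v⁆ = 0)
    (hspan : Submodule.span k {u : V | ∃ (x : L) (v : V), ⁅x, v⁆ = u} = ⊤)
    (v : V) (hv : ∀ x : L, ⁅x, v⁆ = 0) : v = 0 := by
  let := LieRingModule.compLieHom V (A.quotientToEnd h)
  have := LieModule.compLieHom V (A.quotientToEnd h)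
  refine LieModule.eq_zero_of_invariant_of_span_lie_eq_top (k := k) (S := L ⧸ A) ?_ v
    fun x ↦ ?_
  · rw [eq_top_iff, ← hspan]
    refine Submodule.span_mono ?_
    rintro _ ⟨x, u, rfl⟩
    exact ⟨A.quotientMk x, u, rfl⟩
  · obtain ⟨x, rfl⟩ := A.quotientMk_surjective x
    exact hv x

end LieIdeal

/-! ### Algebras whose proper subalgebras are solvable -/

namespace LieAlgebra

variable {k L : Type*} [Field k] [LieRing L] [LieAlgebra k L]

theorem isSolvable_of_isSolvable_quotient (A : LieIdeal k L) [IsLieAbelian A]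
    [h : IsSolvable (L ⧸ A)] : IsSolvable L := by
  obtain ⟨n, hn⟩ := IsSolvable.solvable k (L ⧸ A)
  refine IsSolvable.mk (R := k) (k := n + 1) ?_
  have hle : derivedSeries k L n ≤ A := fun x hx ↦ by
    rw [← A.quotientMk_eq_zero, ← LieSubmodule.mem_bot (R := k) (L := L ⧸ A), ← hn]
    exact LieIdeal.derivedSeries_map_le n (LieIdeal.mem_map hx)
  rw [derivedSeries_def, derivedSeriesOfIdeal_succ, eq_bot_iff]
  refine (LieSubmodule.mono_lie hle hle).trans ?_
  rw [(LieSubmodule.lie_abelian_iff_lie_self_eq_bot A).mp inferInstance]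

variable (k L) in
-- A proper derived ideal would be solvable, and then so would `L`.
theorem derivedSeries_one_eq_top_of_forall_isSolvable (hL : ¬ IsSolvable L)
    (h : ∀ K : LieSubalgebra k L, K ≠ ⊤ → IsSolvable K) : derivedSeries k L 1 = ⊤ := by
  by_contra hne
  have hs : IsSolvable (derivedSeries k L 1) :=
    h (derivedSeries k L 1).toLieSubalgebra fun he ↦ hne <| by
      rw [← LieSubmodule.toSubmodule_inj]
      exact congrArg LieSubalgebra.toSubmodule he
  obtain ⟨n, hn⟩ := IsSolvable.solvable k (derivedSeries k L 1)
  rw [LieIdeal.derivedSeries_eq_bot_iff] at hn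
  exact hL (IsSolvable.mk (R := k) (k := n + 1) (by
    rw [derivedSeries_def, derivedSeriesOfIdeal_add]; exact hn))

theorem isSolvable_quotient_subalgebra (A : LieIdeal k L)
    (h : ∀ K : LieSubalgebra k L, K ≠ ⊤ → IsSolvable K)
    (K : LieSubalgebra k (L ⧸ A)) (hK : K ≠ ⊤) : IsSolvable K := by
  have hne : K.comap A.quotientMk ≠ ⊤ := fun he ↦ hK <| by
    rw [eq_top_iff]
    intro x _
    obtain ⟨x, rfl⟩ := A.quotientMk_surjective x
    have : x ∈ K.comap A.quotientMk := he ▸ LieSubalgebra.mem_top x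
    exact this
  have := h _ hne
  have hr : (A.quotientMk.comp (K.comap A.quotientMk).incl).range = K := by
    ext x
    obtain ⟨x, rfl⟩ := A.quotientMk_surjective x
    constructor
    · rintro ⟨y, hy⟩
      exact hy ▸ y.2
    · exact fun hx ↦ ⟨⟨x, hx⟩, rfl⟩
  exact hr ▸ LieHom.isSolvable_range (A.quotientMk.comp (K.comap A.quotientMk).incl)

theorem isSimple_of_forall_isSolvable [HasTrivialRadical k L] (hL : ¬ IsSolvable L)
    (h : ∀ K : LieSubalgebra k L, K ≠ ⊤ → IsSolvable K) : IsSimple k L where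
  eq_bot_or_eq_top I := by
    by_cases hI : I = ⊤
    · exact Or.inr hI
    · have : IsSolvable I := h I.toLieSubalgebra fun he ↦ hI <| by
        rw [← LieSubmodule.toSubmodule_inj]
        exact congrArg LieSubalgebra.toSubmodule he
      exact Or.inl (HasTrivialRadical.eq_bot_of_isSolvable I)
  non_abelian _ := hL inferInstance

end LieAlgebra

/-! ### Abelian ideals with simple quotient are central -/

namespace LieIdeal

variable {k L : Type*} [Field k] [LieRing L] [LieAlgebra k L] (A : LieIdeal k L)

/-- The linear maps from `L` to the ideal `A` whose restriction to `A` is a scalar. -/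
def scalarRestriction : LieSubmodule k L (L →ₗ[k] L) where
  carrier := {f | (∀ x, f x ∈ A) ∧ ∃ r : k, ∀ a ∈ A, f a = r • a}
  zero_mem' := ⟨fun _ ↦ A.zero_mem, 0, fun a _ ↦ by simp⟩
  add_mem' := by
    rintro f g ⟨hf, r, hr⟩ ⟨hg, s, hs⟩
    exact ⟨fun x ↦ A.add_mem (hf x) (hg x), r + s, fun a ha ↦ by
      rw [LinearMap.add_apply, hr a ha, hs a ha, add_smul]⟩
  smul_mem' := by
    rintro t f ⟨hf, r, hr⟩
    exact ⟨fun x ↦ A.smul_mem t (hf x), t * r, fun a ha ↦ by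
      rw [LinearMap.smul_apply, hr a ha, mul_smul]⟩
  lie_mem := by
    rintro x f ⟨hf, r, hr⟩
    refine ⟨fun y ↦ ?_, 0, fun a ha ↦ ?_⟩
    · rw [LieHom.lie_apply]
      exact A.sub_mem (A.lie_mem (hf y)) (hf _)
    · rw [LieHom.lie_apply, hr a ha, hr _ (A.lie_mem ha), lie_smul, sub_self, zero_smul]

/-- The inner derivations given by elements of the ideal `A`. -/
def innerDerivations : LieSubmodule k L (L →ₗ[k] L) where
  carrier := {f | ∃ a ∈ A, ∀ y, f y = ⁅a, y⁆}
  zero_mem' := ⟨0, A.zero_mem, fun y ↦ by simp⟩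
  add_mem' := by
    rintro f g ⟨a, ha, hf⟩ ⟨b, hb, hg⟩
    exact ⟨a + b, A.add_mem ha hb, fun y ↦ by rw [LinearMap.add_apply, hf, hg, add_lie]⟩
  smul_mem' := by
    rintro t f ⟨a, ha, hf⟩
    exact ⟨t • a, A.smul_mem t ha, fun y ↦ by rw [LinearMap.smul_apply, hf, smul_lie]⟩
  lie_mem := by
    rintro x f ⟨a, ha, hf⟩
    exact ⟨⁅x, a⁆, A.lie_mem ha, fun y ↦ by rw [LieHom.lie_apply, hf, hf, lie_lie]⟩

theorem lie_apply_eq_of_scalar {f : L →ₗ[k] L} (hf : ∀ x, f x ∈ A) [IsLieAbelian A] {r : k}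
    (hr : ∀ a ∈ A, f a = r • a) {a : L} (ha : a ∈ A) (y : L) : ⁅a, f⁆ y = -(r • ⁅a, y⁆) := by
  have h0 : ⁅a, f y⁆ = 0 :=
    congrArg Subtype.val (trivial_lie_zero A A ⟨a, ha⟩ ⟨f y, hf y⟩)
  rw [LieHom.lie_apply, h0, hr _ (lie_mem_left k L A a y ha), zero_sub]

variable [CharZero k] [FiniteDimensional k L] [LieAlgebra.IsSimple k (L ⧸ A)] [IsLieAbelian A]

/-- `A` acts trivially on `M ⧸ P`, so this is a representation of the simple `L ⧸ A`. Brackets land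
in the image of `N` (scalar zero). If all invariants did too, a projection `q` onto `A` would agree
with some `n` in `N` modulo `ad A`; but `ad A` kills the abelian `A`, while `n - q` is `-1` there.
-/
theorem exists_scalar_ne_zero_lie_mem_innerDerivations (hA : A ≠ ⊥) :
    ∃ f : L →ₗ[k] L, (∀ x, f x ∈ A) ∧ (∃ r : k, r ≠ 0 ∧ ∀ a ∈ A, f a = r • a) ∧
      ∀ x : L, ⁅x, f⁆ ∈ A.innerDerivations := by
  by_contra! hcon
  let M := A.scalarRestriction
  let P : LieSubmodule k L M := A.innerDerivations.comap M.incl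
  let N : Submodule k M :=
    { carrier := {f | ∀ a ∈ A, (f : L →ₗ[k] L) a = 0}
      zero_mem' := fun a _ ↦ rfl
      add_mem' := fun {f g} hf hg a ha ↦ by
        simp [hf a ha, hg a ha]
      smul_mem' := fun t f hf a ha ↦ by simp [hf a ha] }
  have hlieN (x : L) (f : M) : ⁅x, f⁆ ∈ N := fun a ha ↦ by
    obtain ⟨hf, r, hr⟩ := f.2
    change ⁅x, (f : L →ₗ[k] L)⁆ a = 0
    rw [LieHom.lie_apply, hr a ha, hr _ (A.lie_mem ha), lie_smul, sub_self]
  have htriv (a : L) (ha : a ∈ A) (v : M ⧸ P) : ⁅a, v⁆ = 0 := by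
    obtain ⟨f, rfl⟩ := LieSubmodule.Quotient.surjective_mk' P v
    rw [← LieModuleHom.map_lie, LieSubmodule.Quotient.mk_eq_zero]
    obtain ⟨hf, r, hr⟩ := f.2
    refine ⟨-(r • a), A.neg_mem (A.smul_mem r ha), fun y ↦ ?_⟩
    rw [neg_lie, smul_lie]
    exact A.lie_apply_eq_of_scalar hf hr ha y
  obtain ⟨p, hp⟩ :=
    A.toSubmodule.subtype.exists_leftInverse_of_injective (Submodule.ker_subtype _)
  have hp' (a : L) (ha : a ∈ A) : (p a : L) = a :=
    congrArg Subtype.val (LinearMap.congr_fun hp ⟨a, ha⟩)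
  let q : M := ⟨A.toSubmodule.subtype ∘ₗ p, fun x ↦ (p x).2, 1, fun a ha ↦ by
    rw [one_smul]; exact hp' a ha⟩
  have hq := A.mem_of_forall_lie_mem_of_forall_invariant_mem htriv
    (N.map (LieSubmodule.Quotient.mk' P : M →ₗ[k] M ⧸ P)) (fun x v ↦ ?_) (fun v hv ↦ ?_)
    (LieSubmodule.Quotient.mk' P q)
  · obtain ⟨n, hn, hnq⟩ := hq
    have hsub : n - q ∈ P := by
      rw [← LieSubmodule.Quotient.mk_eq_zero, map_sub, sub_eq_zero]
      exact hnq
    obtain ⟨b, hb, hbq⟩ := hsub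
    refine hA ((LieSubmodule.eq_bot_iff A).mpr fun a ha ↦ ?_)
    have h1 := hbq a
    have h2 : ⁅b, a⁆ = 0 := congrArg Subtype.val (trivial_lie_zero A A ⟨b, hb⟩ ⟨a, ha⟩)
    rw [h2] at h1
    change (n : L →ₗ[k] L) a - (p a : L) = 0 at h1
    rwa [hn a ha, hp' a ha, zero_sub, neg_eq_zero] at h1
  · obtain ⟨f, rfl⟩ := LieSubmodule.Quotient.surjective_mk' P v
    exact ⟨⁅x, f⁆, hlieN x f, LieModuleHom.map_lie _ x f⟩
  · obtain ⟨f, rfl⟩ := LieSubmodule.Quotient.surjective_mk' P v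
    obtain ⟨hf, r, hr⟩ := f.2
    by_cases hr0 : r = 0
    · exact ⟨f, fun a ha ↦ by rw [hr a ha, hr0, zero_smul], rfl⟩
    · obtain ⟨x, hx⟩ := hcon f hf ⟨r, hr0, hr⟩
      refine (hx ?_).elim
      have := hv x
      rw [← LieModuleHom.map_lie, LieSubmodule.Quotient.mk_eq_zero] at this
      exact this

/-- If all proper subalgebras of `L` are solvable and `L ⧸ A` is simple, where `A` is an abelian
ideal, then `A` is central. -/
theorem lie_eq_zero_of_forall_isSolvable (hL : ¬ LieAlgebra.IsSolvable L)
    (h : ∀ K : LieSubalgebra k L, K ≠ ⊤ → LieAlgebra.IsSolvable K) (hA : A ≠ ⊥)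
    {a : L} (ha : a ∈ A) (y : L) : ⁅a, y⁆ = 0 := by
  obtain ⟨f, hf, ⟨r, hr0, hr⟩, hlie⟩ := A.exists_scalar_ne_zero_lie_mem_innerDerivations hA
  let C : LieSubalgebra k L :=
    { carrier := {x | ⁅x, f⁆ = 0}
      zero_mem' := zero_lie f
      add_mem' := fun {x y} hx hy ↦ by
        change ⁅x + y, f⁆ = 0
        rw [add_lie, hx, hy, add_zero]
      smul_mem' := fun t x hx ↦ by
        change ⁅t • x, f⁆ = 0
        rw [smul_lie, hx, smul_zero]
      lie_mem' := fun {x y} hx hy ↦ by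
        change ⁅x, f⁆ = 0 at hx
        change ⁅y, f⁆ = 0 at hy
        change ⁅⁅x, y⁆, f⁆ = 0
        rw [lie_lie, hx, hy, lie_zero, lie_zero, sub_zero] }
  have hC : C = ⊤ := by
    by_contra hne
    have := h C hne
    have hsurj : Function.Surjective (A.quotientMk.comp C.incl) := fun v ↦ by
      obtain ⟨x, rfl⟩ := A.quotientMk_surjective v
      obtain ⟨b, hb, hbx⟩ := hlie x
      have hbA : r⁻¹ • b ∈ A := A.smul_mem _ hb
      -- On `A` one has `⁅a, f⁆ = -r • ad a`, so this correction cancels `⁅x, f⁆ = ad b` without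
      -- changing the class modulo `A`.
      refine ⟨⟨x + r⁻¹ • b, ?_⟩, ?_⟩
      · change ⁅x + r⁻¹ • b, f⁆ = 0
        ext y
        rw [add_lie, LinearMap.add_apply, hbx, A.lie_apply_eq_of_scalar hf hr hbA, smul_lie,
          smul_inv_smul₀ hr0, add_neg_cancel, LinearMap.zero_apply]
      · change A.quotientMk (x + r⁻¹ • b) = A.quotientMk x
        rw [map_add, A.quotientMk_eq_zero.mpr hbA, add_zero]
    have := hsurj.lieAlgebra_isSolvable
    exact hL (LieAlgebra.isSolvable_of_isSolvable_quotient A)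
  have haC : a ∈ C := hC ▸ LieSubalgebra.mem_top a
  have h0 : ⁅a, f⁆ y = 0 := by
    rw [show ⁅a, f⁆ = 0 from haC, LinearMap.zero_apply]
  rw [A.lie_apply_eq_of_scalar hf hr ha, neg_eq_zero] at h0
  exact (smul_eq_zero.mp h0).resolve_left hr0

end LieIdeal

/-! ### Semisimple subalgebras of nonsolvable algebras -/

namespace LieAlgebra

variable {k L : Type*} [Field k] [CharZero k] [LieRing L] [LieAlgebra k L] [FiniteDimensional k L]

/-- A nonsolvable Lie algebra all of whose proper subalgebras are solvable has trivial radical. -/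
theorem hasTrivialRadical_of_forall_isSolvable (hL : ¬ IsSolvable L)
    (h : ∀ K : LieSubalgebra k L, K ≠ ⊤ → IsSolvable K) : HasTrivialRadical k L := by
  induction hn : Module.finrank k L using Nat.strong_induction_on generalizing L with
  | _ n ih =>
  rw [hasTrivialRadical_iff_no_abelian_ideals]
  intro A hA
  by_contra hA0
  have hq : ¬ IsSolvable (L ⧸ A) := fun _ ↦ hL (isSolvable_of_isSolvable_quotient A)
  have hqs := isSolvable_quotient_subalgebra A h
  have hlt : Module.finrank k (L ⧸ A) < n := by
    have h1 := A.toSubmodule.finrank_quotient_add_finrank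
    have h2 : 0 < Module.finrank k A.toSubmodule := by
      rw [Nat.pos_iff_ne_zero, Ne, Submodule.finrank_eq_zero]
      simpa using hA0
    have h3 : Module.finrank k (L ⧸ A) = Module.finrank k (L ⧸ A.toSubmodule) := rfl
    omega
  have := ih _ hlt hq hqs rfl
  have := isSimple_of_forall_isSolvable hq hqs
  have hcentral := @LieIdeal.lie_eq_zero_of_forall_isSolvable k L _ _ _ A _ _ _ _ hL h hA0
  refine hA0 ((LieSubmodule.eq_bot_iff A).mpr fun a ha ↦ ?_)
  refine A.eq_zero_of_invariant_of_span_lie_eq_top (fun a ha v ↦ hcentral ha v) ?_ a fun x ↦ ?_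
  · rw [← coe_derivedSeries_one_eq, derivedSeries_one_eq_top_of_forall_isSolvable k L hL h]
    rfl
  · rw [← lie_skew, hcentral ha, neg_zero]

variable (k L) in
/-- A nonsolvable finite-dimensional Lie algebra over a field of characteristic zero has a
nonzero subalgebra with trivial radical. -/
theorem exists_subalgebra_hasTrivialRadical (hL : ¬ IsSolvable L) :
    ∃ K : LieSubalgebra k L, HasTrivialRadical k K ∧ K ≠ ⊥ := by
  obtain ⟨K, hK, hmin⟩ := WellFounded.has_min
    (InvImage.wf (fun K : LieSubalgebra k L ↦ Module.finrank k K) Nat.lt_wfRel.wf)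
    {K | ¬ IsSolvable K} ⟨⊤, fun hs ↦ hL ((solvable_iff_equiv_solvable
      (LieSubalgebra.topEquiv (R := k) (L := L))).mp hs)⟩
  refine ⟨K, hasTrivialRadical_of_forall_isSolvable hK fun K' hK' ↦ ?_, ?_⟩
  · by_contra hns
    refine hmin (K'.map K.incl) (fun hs ↦ hns ?_) ?_
    · have hinj : Function.Injective K.incl := Subtype.val_injective
      exact (solvable_iff_equiv_solvable (K'.equivMapOfInjective K.incl hinj)).mpr hs
    · have hlt : Module.finrank k K' < Module.finrank k K := by
        refine Submodule.finrank_lt (s := K'.toSubmodule) fun he ↦ hK' ?_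
        rw [← LieSubalgebra.toSubmodule_inj]
        exact he
      refine lt_of_le_of_lt ?_ hlt
      exact Submodule.finrank_map_le (K.incl : K →ₗ[k] L) K'.toSubmodule
  · rintro rfl
    have : IsLieAbelian (⊥ : LieSubalgebra k L) := ⟨fun x y ↦ Subtype.ext
      ((LieSubalgebra.mem_bot _).mp ⁅x, y⁆.2)⟩
    exact hK inferInstance

end LieAlgebra

/-! ### Morphisms to solvable algebras, and the theorem -/

namespace LieAlgebra

variable {k S L : Type*} [Field k] [CharZero k] [LieRing S] [LieAlgebra k S]
  [FiniteDimensional k S] [HasTrivialRadical k S] [LieRing L] [LieAlgebra k L]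

/-- A morphism from a semisimple Lie algebra to a solvable one vanishes. -/
theorem eq_zero_of_hasTrivialRadical_of_isSolvable [IsSolvable L] (f : S →ₗ⁅k⁆ L) (s : S) :
    f s = 0 := by
  let I : LieIdeal k S := f.ker
  have hI : IsCompl I I.killingCompl := I.isCompl_killingCompl
  have hinj : Function.Injective (f.comp I.killingCompl.incl) := by
    rw [injective_iff_map_eq_zero]
    rintro ⟨x, hx⟩ h0
    have : x ∈ I ⊓ I.killingCompl := ⟨f.mem_ker.mpr h0, hx⟩
    rw [hI.inf_eq_bot, LieSubmodule.mem_bot] at this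
    exact Subtype.ext this
  have := hinj.lieAlgebra_isSolvable
  have h0 := HasTrivialRadical.eq_bot_of_isSolvable I.killingCompl
  have htop : I = ⊤ := by simpa [h0] using hI.sup_eq_top
  exact f.mem_ker.mp (show s ∈ I from htop ▸ LieSubmodule.mem_top s)

end LieAlgebra

theorem mainTheorem11 (k : Type u) [Field k] [CharZero k]
    (R : Type v) [LieRing R] [LieAlgebra k R] [FiniteDimensional k R]
    [LieAlgebra.IsSolvable R] :
    AdmitsNontrivialLeviExtension k R ↔ ¬ LieAlgebra.IsSolvable (LieDerivation k R R) := by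
  constructor
  · rintro ⟨S, _, _, _, _, ρ, hρ, s, a, hsa⟩ hs
    choose D hD using hρ
    have hinj := LieDerivation.toLinearMapLieHom_injective k R
    let f : S →ₗ⁅k⁆ LieDerivation k R R :=
      { toFun := D
        map_add' := fun x y ↦ hinj <| by
          change (D (x + y) : R →ₗ[k] R) = D x + D y
          rw [hD, hD, hD, map_add]
        map_smul' := fun t x ↦ hinj <| by
          change (D (t • x) : R →ₗ[k] R) = t • (D x : R →ₗ[k] R)
          rw [hD, hD, map_smul]
        map_lie' := fun {x y} ↦ hinj <| by
          rw [LieHom.map_lie]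
          change (D ⁅x, y⁆ : Module.End k R) = ⁅(D x : Module.End k R), (D y : Module.End k R)⁆
          rw [hD, hD, hD, LieHom.map_lie] }
    have h0 : D s = 0 := LieAlgebra.eq_zero_of_hasTrivialRadical_of_isSolvable f s
    apply hsa
    rw [← hD s, h0]
    rfl
  · intro hns
    obtain ⟨K, hK, hne⟩ :=
      LieAlgebra.exists_subalgebra_hasTrivialRadical k (LieDerivation k R R) hns
    refine ⟨K, inferInstance, inferInstance, inferInstance, hK,
      (LieDerivation.toLinearMapLieHom k R).comp K.incl, fun s ↦ ⟨s, rfl⟩, ?_⟩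
    by_contra! hcon
    refine hne ((LieSubalgebra.eq_bot_iff K).mpr fun D hD ↦ ?_)
    ext a
    exact hcon ⟨D, hD⟩ a
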